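/- Let $\mathcal H$ be a (complex) reproducing kernel Hilbert space on a set $X$ with kernel $k$. Let $\mathrm{Mult}(\mathcal H)$ be the algebra of functions $\varphi: X\to\mathbb C$ with $\varphi f\in\mathcal H$ for all $f\in\mathcal H$, with the norm $\|\varphi\|_{\mathrm{Mult}(\mathcal H)}=\|M_\varphi\|$, where $M_\varphi$ is the (bounded) multiplication operator $f\mapsto\varphi f$ on $\mathcal H$. A multiplier is called cyclic if $M_\varphi$ has dense range. The space $\mathcal H$ is a complete Pick space if for all $r,n\in\mathbb N$, all points $z_1,\dots,z_n\in X$ and all $W_1,\dots,W_n\in M_r(\mathbb C)$, positive semidefiniteness of the block matrix $[k(z_i,z_j)(I-W_iW_j^*)]_{i,j=1}^n$ implies that there is $\Phi\in M_r(\mathrm{Mult}(\mathcal H))$, of norm at most $1$ as an operator on $\mathcal H^r$, such that $\Phi(z_i)=W_i$ for all $i$. Put $$N^+(\mathcal H)=\{\varphi/\psi:\ \varphi,\psi\in\mathrm{Mult}(\mathcal H),\ \psi\text{ cyclic}\}.$$ Suppose that $\mathcal H$ is a complete Pick space whose kernel is normalized at $x_0\in X$, that is, $k(x,x_0)=1$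 for all $x\in X$. Then for every $f\in\mathcal H$ with $\|f\|_{\mathcal H}\le 1$ there are $\varphi,\psi\in\mathrm{Mult}(\mathcal H)$ of multiplier norm at most $1$ with $\psi(x_0)=0$ such that $1-\psi$ is a cyclic multiplier without zeros on $X$ and $$f=\frac{\varphi}{1-\psi}.$$ In particular, $\mathcal H\subset N^+(\mathcal H)$. -/

import Mathlib

namespace PickSpace

open scoped ComplexOrder

section

variable {X : Type*} (H : Type*) [NormedAddCommGroup H] [InnerProductSpace ℂ H]
  [RKHS ℂ H X ℂ]

/-- The multiplier algebra: all functions `φ : X → ℂ` with `φ f ∈ H` for all `f ∈ H`. -/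
def Mult : Subalgebra ℂ (X → ℂ) where
  carrier := {φ | ∀ f : H, ∃ g : H, (g : X → ℂ) = φ * (f : X → ℂ)}
  mul_mem' := by
    intro φ ψ hφ hψ f
    obtain ⟨g, hg⟩ := hψ f
    obtain ⟨h, hh⟩ := hφ g
    exact ⟨h, by rw [hh, hg, mul_assoc]⟩
  add_mem' := by
    intro φ ψ hφ hψ f
    obtain ⟨g, hg⟩ := hφ f
    obtain ⟨h, hh⟩ := hψ f
    exact ⟨g + h, by rw [RKHS.coe_add, hg, hh, add_mul]⟩
  algebraMap_mem' := by
    intro c f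
    exact ⟨c • f, by rw [RKHS.coe_smul, Algebra.smul_def]⟩

variable {H}

/-- The element `φ f` of `H`. -/
noncomputable def mulFun (φ : Mult (X := X) H) (f : H) : H := Classical.choose (φ.2 f)

theorem mulFun_apply (φ : Mult (X := X) H) (f : H) (x : X) :
    mulFun φ f x = (φ : X → ℂ) x * f x :=
  congrFun (Classical.choose_spec (φ.2 f)) x

/-- Multiplication by a multiplier, as a linear map on `H`. -/
noncomputable def mulLin (φ : Mult (X := X) H) : H →ₗ[ℂ] H where
  toFun := mulFun φ
  map_add' f g := by
    apply RKHS.ext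
    intro x
    simp [mulFun_apply, mul_add]
  map_smul' c f := by
    apply RKHS.ext
    intro x
    simp [mulFun_apply, mul_left_comm]

theorem mulLin_apply (φ : Mult (X := X) H) (f : H) (x : X) :
    mulLin φ f x = (φ : X → ℂ) x * f x :=
  mulFun_apply φ f x

variable (H)

variable [CompleteSpace H]

/-- The scalar reproducing kernel `k(z, w)` of a Hilbert space `H` of complex-valued functions. -/
noncomputable def k (z w : X) : ℂ := RKHS.kernel H z w 1

/-- `k(z, w) = k_w(z)`, where `k_w` is the element of `H` that represents evaluation at `w`. -/
theorem k_eq (z w : X) : k H z w = RKHS.kerFun H w 1 z :=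
  (RKHS.kerFun_apply H w 1 z).symm

/-- The kernel is normalized at `x₀`. -/
def IsNormalizedAt (x₀ : X) : Prop := ∀ x : X, k H x x₀ = 1

variable {H}

/-- The multiplication operator `M_φ` on `H`; it is bounded by the closed graph theorem. -/
noncomputable def mulOp (φ : Mult (X := X) H) : H →L[ℂ] H :=
  ContinuousLinearMap.ofSeqClosedGraph (g := mulLin φ) (by
    intro u f g hu hg
    apply RKHS.ext
    intro x
    rw [mulLin_apply]
    have h1 := ((RKHS.continuous_eval (H := H) x).tendsto g).comp hg
    have h2 := (((RKHS.continuous_eval (H := H) x).tendsto f).comp hu).const_mul ((φ : X → ℂ) x)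
    refine tendsto_nhds_unique h1 (h2.congr fun n => ?_)
    exact (mulLin_apply φ (u n) x).symm)

theorem mulOp_apply (φ : Mult (X := X) H) (f : H) (x : X) :
    mulOp φ f x = (φ : X → ℂ) x * f x :=
  mulLin_apply φ f x

/-- The multiplier norm. -/
noncomputable def multNorm (φ : Mult (X := X) H) : ℝ := ‖mulOp φ‖

/-- A multiplier is cyclic if its multiplication operator has dense range. -/
def IsCyclicMult (φ : Mult (X := X) H) : Prop := DenseRange (mulOp φ)

/-- The operator of an `r × r` matrix of multipliers on the Hilbert space direct sum of `r`
copies of `H`: the `i`-th component of `Φ h` is `∑ j, Φ i j * h j`. -/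
noncomputable def matMulOp {r : ℕ} (Φ : Matrix (Fin r) (Fin r) (Mult (X := X) H)) :
    PiLp 2 (fun _ : Fin r => H) →L[ℂ] PiLp 2 (fun _ : Fin r => H) :=
  ((PiLp.continuousLinearEquiv 2 ℂ (fun _ : Fin r => H)).symm :
      (Fin r → H) →L[ℂ] PiLp 2 (fun _ : Fin r => H)) ∘L
    ContinuousLinearMap.pi fun i =>
      ∑ j, mulOp (Φ i j) ∘L PiLp.proj (𝕜 := ℂ) 2 (fun _ : Fin r => H) j

theorem matMulOp_apply {r : ℕ} (Φ : Matrix (Fin r) (Fin r) (Mult (X := X) H))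
    (h : PiLp 2 (fun _ : Fin r => H)) (i : Fin r) :
    matMulOp Φ h i = ∑ j, mulOp (Φ i j) (h j) := by
  simp [matMulOp]

variable (H)

/-- The block matrix `[k(z_i, z_j) (I - W_i W_j^*)]`. -/
noncomputable def pickMatrix {n r : ℕ} (z : Fin n → X) (W : Fin n → Matrix (Fin r) (Fin r) ℂ) :
    Matrix (Fin n × Fin r) (Fin n × Fin r) ℂ :=
  Matrix.of fun p q => k H (z p.1) (z q.1) * (1 - W p.1 * (W q.1).conjTranspose) p.2 q.2

/-- `H` is a complete Pick space: every matrix-valued finite interpolation problem whose Pick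
matrix is positive semidefinite has a solution in the unit ball of `M_r(Mult H)`. -/
def IsCompletePick : Prop :=
  ∀ (r n : ℕ) (z : Fin n → X) (W : Fin n → Matrix (Fin r) (Fin r) ℂ),
    (pickMatrix H z W).PosSemidef →
      ∃ Φ : Matrix (Fin r) (Fin r) (Mult (X := X) H),
        ‖matMulOp Φ‖ ≤ 1 ∧ ∀ i a b, (Φ a b : X → ℂ) (z i) = W i a b

/-- The Smirnov class `N⁺(H)` of quotients of a multiplier by a cyclic multiplier. -/
def smirnov : Set (X → ℂ) :=
  {g | ∃ φ ψ : Mult (X := X) H, IsCyclicMult ψ ∧ g = fun x => (φ : X → ℂ) x / (ψ : X → ℂ) x}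

end

end PickSpace

namespace PickSpace

/-!
By the theorem of McCullough and Quiggin, a normalized complete Pick kernel has the form
`k(x, y) = 1 / (1 - ⟨b x, b y⟩)`. This is proved by induction on the number of points: a positive
semidefinite `pickDefect q` is factored as `C* C`, the Pick property extends the rows of `C` to a
contractive row of multipliers, and compressing that row to the functions that vanish at `p` shows
that `pickDefect p` is positive semidefinite.

The identity `k = 1 + ⟨b, b⟩ k` yields a contraction `ℂ ⊕ (G ⊗ H) → H`. Combined with the rank one
contraction given by `f`, it is the colligation of a transfer function with inputs `c` and `d`,
whose values at `(1, 0)` and `(0, 1)` are contractive multipliers `φ` and `ψ`. The vector `k_w`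
itself solves the state equation with input `(1, conj (f w))`, so by uniqueness of the state
`f = φ + f ψ`.

Since `ψ(x₀) = 0`, the maximum principle shows that `1 - ψ` has no zeros. A vector orthogonal to
the range of `1 - M_ψ` is fixed by the adjoint of the contraction `M_ψ`, hence by `M_ψ`, hence is
zero; so `1 - ψ` is cyclic.
-/

universe u

open scoped ComplexOrder ComplexConjugate InnerProductSpace Kronecker Matrix TensorProduct
open Matrix (gram)

section PosSemidef

theorem posSemidef_of_forall_submatrix_fin {R ι : Type*} [Ring R] [PartialOrder R] [StarRing R]
    {A : Matrix ι ι R} (h : ∀ (n : ℕ) (z : Fin n → ι), (A.submatrix z z).PosSemidef) :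
    A.PosSemidef := by
  classical
  refine ⟨?_, fun c => ?_⟩
  · ext i j
    simpa using (h 2 ![i, j]).1.apply 0 1
  · have hsupp : (A.submatrix (↑) (↑) : Matrix c.support c.support R).PosSemidef := by
      simpa [Matrix.submatrix_submatrix, Function.comp_def] using
        (h _ fun i => (c.support.equivFin.symm i : ι)).submatrix c.support.equivFin
    simpa [Finsupp.sum, ← Finset.sum_attach c.support, ← Finset.subtype_mem_eq_attach,
      ← Finsupp.subtypeDomain_apply, ← Finsupp.support_subtypeDomain] using hsupp.2 _

theorem posSemidef_of_submatrix_succ {R : Type*} [Ring R] [PartialOrder R] [StarRing R] {n : ℕ}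
    {A : Matrix (Fin (n + 1)) (Fin (n + 1)) R} (hrow : ∀ j, A 0 j = 0) (hcol : ∀ i, A i 0 = 0)
    (h : (A.submatrix Fin.succ Fin.succ).PosSemidef) : A.PosSemidef := by
  refine .of_dotProduct_mulVec_nonneg ?_ fun c => ?_
  · refine Matrix.IsHermitian.ext fun i j => ?_
    cases i using Fin.cases with
    | zero => simp [hrow, hcol]
    | succ i =>
      cases j using Fin.cases with
      | zero => simp [hrow, hcol]
      | succ j => exact h.1.apply i j
  · simpa [dotProduct, Matrix.mulVec, Fin.sum_univ_succ, hrow, hcol] using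
      h.dotProduct_mulVec_nonneg (c ∘ Fin.succ)

variable {𝕜 ι E F : Type*} [RCLike 𝕜] [NormedAddCommGroup E] [InnerProductSpace 𝕜 E]
  [NormedAddCommGroup F] [InnerProductSpace 𝕜 F]

theorem sum_star_mul_gram_mul (v : ι → E) (c : ι →₀ 𝕜) :
    (c.sum fun i ci => c.sum fun j cj => star ci * gram 𝕜 v i j * cj) =
      ((‖Finsupp.linearCombination 𝕜 v c‖ ^ 2 : ℝ) : 𝕜) := by
  rw [RCLike.ofReal_pow, ← inner_self_eq_norm_sq_to_K, Finsupp.linearCombination_apply,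
    Finsupp.sum_inner]
  refine Finsupp.sum_congr fun i _ => ?_
  rw [Finsupp.inner_sum]
  refine Finsupp.sum_congr fun j _ => ?_
  simp only [Matrix.gram_apply, inner_smul_left, inner_smul_right, RCLike.star_def]
  ring

theorem posSemidef_gram_sub_gram_iff {v : ι → E} {u : ι → F} :
    (gram 𝕜 v - gram 𝕜 u).PosSemidef ↔
      ∀ c, ‖Finsupp.linearCombination 𝕜 u c‖ ≤ ‖Finsupp.linearCombination 𝕜 v c‖ := by
  have quadratic_form (c : ι →₀ 𝕜) :
      (c.sum fun i ci => c.sum fun j cj => star ci * (gram 𝕜 v - gram 𝕜 u) i j * cj) =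
        ((‖Finsupp.linearCombination 𝕜 v c‖ ^ 2 -
          ‖Finsupp.linearCombination 𝕜 u c‖ ^ 2 : ℝ) : 𝕜) := by
    rw [RCLike.ofReal_sub, ← sum_star_mul_gram_mul, ← sum_star_mul_gram_mul]
    simp [Finsupp.sum, mul_sub, sub_mul, Finset.sum_sub_distrib]
  have hherm : (gram 𝕜 v - gram 𝕜 u).IsHermitian :=
    (Matrix.isHermitian_gram 𝕜 v).sub (Matrix.isHermitian_gram 𝕜 u)
  refine (and_iff_right hherm).trans (forall_congr' fun c => ?_)
  rw [quadratic_form, RCLike.ofReal_nonneg, sub_nonneg,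
    sq_le_sq₀ (norm_nonneg _) (norm_nonneg _)]

theorem posSemidef_gram (v : ι → E) : (gram 𝕜 v).PosSemidef := by
  have h : (gram 𝕜 v - gram 𝕜 (0 : ι → 𝕜)).PosSemidef :=
    posSemidef_gram_sub_gram_iff.2 fun c => by simp [Finsupp.linearCombination_apply]
  simpa using h

theorem posSemidef_gram_sub_gram_map {T : E →L[𝕜] F} (hT : ‖T‖ ≤ 1) (v : ι → E) :
    (gram 𝕜 v - gram 𝕜 (T ∘ v)).PosSemidef := by
  refine posSemidef_gram_sub_gram_iff.2 fun c => ?_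
  have hmap : Finsupp.linearCombination 𝕜 (T ∘ v) c = T (Finsupp.linearCombination 𝕜 v c) := by
    simp [Finsupp.linearCombination_apply, Finsupp.sum]
  simpa [hmap] using T.le_of_opNorm_le hT (Finsupp.linearCombination 𝕜 v c)

theorem exists_contraction_of_posSemidef_gram_sub_gram [CompleteSpace F] {v : ι → E} {u : ι → F}
    (hv : (Submodule.span 𝕜 (Set.range v)).topologicalClosure = ⊤)
    (h : (gram 𝕜 v - gram 𝕜 u).PosSemidef) :
    ∃ T : E →L[𝕜] F, ‖T‖ ≤ 1 ∧ ∀ i, T (v i) = u i := by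
  have hdense : DenseRange (Finsupp.linearCombination 𝕜 v) := by
    rwa [DenseRange, ← LinearMap.coe_range, Finsupp.range_linearCombination,
      Submodule.dense_iff_topologicalClosure_eq_top]
  have hbound (c : ι →₀ 𝕜) : ‖Finsupp.linearCombination 𝕜 u c‖ ≤
      1 * ‖Finsupp.linearCombination 𝕜 v c‖ := by
    simpa using posSemidef_gram_sub_gram_iff.1 h c
  refine ⟨(Finsupp.linearCombination 𝕜 u).extendOfNorm (Finsupp.linearCombination 𝕜 v),
    LinearMap.opNorm_extendOfNorm_le hdense zero_le_one hbound, fun i => ?_⟩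
  simpa using LinearMap.extendOfNorm_eq hdense ⟨1, hbound⟩ (Finsupp.single i 1)

theorem exists_gram_eq_of_posSemidef {X : Type u} {A : Matrix X X ℂ} (hA : A.PosSemidef) :
    ∃ (G : Type u) (_ : NormedAddCommGroup G) (_ : InnerProductSpace ℂ G) (b : X → G),
      gram ℂ b = A := by
  let K : Matrix X X (ℂ →L[ℂ] ℂ) := A.map fun a => a • ContinuousLinearMap.id ℂ ℂ
  have quadratic_form (v : X →₀ ℂ) :
      (v.sum fun x w => v.sum fun x' w' => ⟪K x' x w, w'⟫_ℂ) =
        conj (v.sum fun i xi => v.sum fun j xj => star xi * A i j * xj) := by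
    rw [Finsupp.sum_comm]
    simp only [Finsupp.sum, map_sum]
    refine Finset.sum_congr rfl fun i _ => Finset.sum_congr rfl fun j _ => ?_
    simp [K, mul_comm, mul_left_comm]
  have hK : K.PosSemidef := by
    have hiff : K.PosSemidef ↔ _ := (RKHS.posSemidef_tfae (K := K)).out 0 2
    refine hiff.2 ⟨?_, fun v => ?_⟩
    · ext x y
      simp [K, ContinuousLinearMap.star_eq_adjoint, ContinuousLinearMap.adjoint_id,
        ← hA.1.apply x y]
    · rw [quadratic_form]
      simpa using (Complex.le_def.1 (hA.2 v)).1
  have : Fact K.PosSemidef := ⟨hK⟩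
  refine ⟨RKHS.OfKernel K, inferInstance, inferInstance,
    fun x => RKHS.kerFun (RKHS.OfKernel K) x 1, ?_⟩
  ext x y
  simpa [RKHS.kerFun_apply, RKHS.OfKernel.kernel_ofKernel, K] using hA.1.apply x y

end PosSemidef

section FixedVectors

variable {𝕜 E : Type*} [RCLike 𝕜] [NormedAddCommGroup E] [InnerProductSpace 𝕜 E] [CompleteSpace E]

theorem apply_eq_smul_of_adjoint_apply_eq_smul {T : E →L[𝕜] E} (hT : ‖T‖ ≤ 1) {μ : 𝕜}
    (hμ : ‖μ‖ = 1) {v : E} (hv : T.adjoint v = conj μ • v) : T v = μ • v := by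
  have hinner : ⟪T v, μ • v⟫_𝕜 = ((‖v‖ ^ 2 : ℝ) : 𝕜) := by
    rw [← ContinuousLinearMap.adjoint_inner_right, map_smul, hv, smul_smul, RCLike.mul_conj, hμ]
    simp [inner_self_eq_norm_sq_to_K]
  have hnorm : ‖T v‖ ^ 2 ≤ ‖v‖ ^ 2 := by
    gcongr
    simpa using T.le_of_opNorm_le hT v
  have hdist : ‖T v - μ • v‖ ^ 2 ≤ 0 := by
    rw [norm_sub_sq (𝕜 := 𝕜), hinner, norm_smul, hμ, RCLike.ofReal_re]
    linarith
  exact sub_eq_zero.1 (norm_eq_zero.1 (pow_eq_zero_iff two_ne_zero |>.1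
    (le_antisymm hdist (sq_nonneg _))))

end FixedVectors

section Kernel

variable {X H : Type*} [NormedAddCommGroup H] [InnerProductSpace ℂ H] [CompleteSpace H]
  [RKHS ℂ H X ℂ]

variable (H) in
/-- The kernel function `k_x`, the element of `H` that represents evaluation at `x`. -/
noncomputable def kerVec (x : X) : H := RKHS.kerFun H x 1

theorem inner_kerVec_left (x : X) (f : H) : ⟪kerVec H x, f⟫_ℂ = f x := by
  simp [kerVec]

theorem kerVec_apply (x y : X) : kerVec H y x = k H x y :=
  (k_eq H x y).symm

theorem inner_kerVec_kerVec (x y : X) : ⟪kerVec H x, kerVec H y⟫_ℂ = k H x y := by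
  rw [inner_kerVec_left, kerVec_apply]

variable (H) in
theorem gram_kerVec : gram ℂ (kerVec H : X → H) = .of (k H) := by
  ext x y
  simp [inner_kerVec_kerVec]

theorem conj_k (x y : X) : conj (k H x y) = k H y x := by
  rw [← inner_kerVec_kerVec, ← inner_kerVec_kerVec, inner_conj_symm]

theorem topologicalClosure_span_kerVec :
    (Submodule.span ℂ (Set.range (kerVec H : X → H))).topologicalClosure = ⊤ := by
  refine Submodule.topologicalClosure_eq_top_iff.2 ((Submodule.eq_bot_iff _).2 fun f hf => ?_)
  refine RKHS.ext fun x => ?_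
  rw [← inner_kerVec_left, RKHS.coe_zero, Pi.zero_apply]
  exact hf _ (Submodule.subset_span ⟨x, rfl⟩)

theorem exists_contraction_apply_eq_inner {E : Type*} [NormedAddCommGroup E]
    [InnerProductSpace ℂ E] {e : X → E} (he : (gram ℂ (kerVec H) - gram ℂ e).PosSemidef) :
    ∃ T : E →L[ℂ] H, ‖T‖ ≤ 1 ∧ ∀ v x, T v x = ⟪e x, v⟫_ℂ := by
  have he' : (gram ℂ (kerVec H) -
      gram ℂ fun x => (e x : UniformSpace.Completion E)).PosSemidef := by
    simpa [Matrix.gram] using he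
  obtain ⟨S, hS, hSe⟩ :=
    exists_contraction_of_posSemidef_gram_sub_gram topologicalClosure_span_kerVec he'
  refine ⟨S.adjoint ∘L UniformSpace.Completion.toComplL, ?_, fun v x => ?_⟩
  · refine ContinuousLinearMap.opNorm_le_bound _ zero_le_one fun v => ?_
    rw [← UniformSpace.Completion.norm_coe v]
    exact S.adjoint.le_of_opNorm_le ((LinearIsometryEquiv.norm_map _ S).trans_le hS) _
  · rw [← inner_kerVec_left, ContinuousLinearMap.comp_apply,
      ContinuousLinearMap.adjoint_inner_right, hSe]
    simp

theorem exists_mult_of_posSemidef {φ : X → ℂ}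
    (h : (Matrix.of fun x y => k H x y * (1 - φ x * conj (φ y))).PosSemidef) :
    ∃ Φ : Mult (X := X) H, (Φ : X → ℂ) = φ ∧ multNorm Φ ≤ 1 := by
  have hgram : (gram ℂ (kerVec H) - gram ℂ fun x => conj (φ x) • kerVec H x).PosSemidef := by
    convert h using 1
    ext x y
    simp only [Matrix.sub_apply, Matrix.gram_apply, inner_smul_left, inner_smul_right,
      inner_kerVec_kerVec, RCLike.conj_conj, Matrix.of_apply]
    ring
  obtain ⟨T, hT, hTe⟩ := exists_contraction_apply_eq_inner hgram
  have hTφ (f : H) (x : X) : T f x = φ x * f x := by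
    rw [hTe, inner_smul_left, inner_kerVec_left, RCLike.conj_conj]
  let Φ : Mult (X := X) H := ⟨φ, fun f => ⟨T f, funext (hTφ f)⟩⟩
  have hΦ : mulOp Φ = T := by
    ext f x
    rw [mulOp_apply, hTφ]
  exact ⟨Φ, rfl, by rwa [multNorm, hΦ]⟩

theorem adjoint_mulOp_kerVec (φ : Mult (X := X) H) (x : X) :
    (mulOp φ).adjoint (kerVec H x) = conj ((φ : X → ℂ) x) • kerVec H x := by
  refine ext_inner_right ℂ fun f => ?_
  rw [ContinuousLinearMap.adjoint_inner_left, inner_kerVec_left, mulOp_apply, inner_smul_left,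
    inner_kerVec_left, RCLike.conj_conj]

theorem apply_eq_of_norm_apply_eq_one {ψ : Mult (X := X) H} (hψ : multNorm ψ ≤ 1) {x y : X}
    (hx : ‖(ψ : X → ℂ) x‖ = 1) (hxy : k H y x ≠ 0) : (ψ : X → ℂ) y = (ψ : X → ℂ) x := by
  have h := apply_eq_smul_of_adjoint_apply_eq_smul hψ hx (adjoint_mulOp_kerVec ψ x)
  have hy : (ψ : X → ℂ) y * k H y x = (ψ : X → ℂ) x * k H y x := by
    rw [← kerVec_apply, ← mulOp_apply, h, RKHS.coe_smul, Pi.smul_apply, smul_eq_mul]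
  exact mul_right_cancel₀ hxy hy

theorem isCyclicMult_one_sub {ψ : Mult (X := X) H} (hψ : multNorm ψ ≤ 1)
    (hψ₁ : ∀ x, 1 - (ψ : X → ℂ) x ≠ 0) : IsCyclicMult (1 - ψ) := by
  have hop : mulOp (1 - ψ) = .id ℂ H - mulOp ψ := by
    ext f x
    simp [mulOp_apply, sub_mul]
  suffices h : (mulOp (1 - ψ)).rangeᗮ = ⊥ from
    Submodule.dense_iff_topologicalClosure_eq_top.2 (Submodule.topologicalClosure_eq_top_iff.2 h)
  rw [ContinuousLinearMap.orthogonal_range, LinearMap.ker_eq_bot']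
  intro h hh
  have hfix : (mulOp ψ).adjoint h = conj (1 : ℂ) • h := by
    rw [map_one, one_smul]
    refine (sub_eq_zero.1 ?_).symm
    simpa [hop, ContinuousLinearMap.adjoint_id] using hh
  have hψh := apply_eq_smul_of_adjoint_apply_eq_smul hψ norm_one hfix
  refine RKHS.ext fun x => ?_
  have hx : (1 - (ψ : X → ℂ) x) * h x = 0 := by
    rw [sub_mul, ← mulOp_apply, hψh, one_smul, one_mul, sub_self]
  simpa using (mul_eq_zero.1 hx).resolve_left (hψ₁ x)

end Kernel

section RowMultiplier

variable {X H ι : Type*} [NormedAddCommGroup H] [InnerProductSpace ℂ H] [CompleteSpace H]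
  [RKHS ℂ H X ℂ] [Fintype ι]

/-- The operator `h ↦ ∑ l, φ l * h l` of a row of multipliers, from the Hilbert space direct sum
of copies of `H` to `H`. -/
noncomputable def rowMulOp (φ : ι → Mult (X := X) H) : PiLp 2 (fun _ : ι => H) →L[ℂ] H :=
  ∑ l, mulOp (φ l) ∘L PiLp.proj (𝕜 := ℂ) 2 (fun _ : ι => H) l

theorem rowMulOp_apply (φ : ι → Mult (X := X) H) (h : PiLp 2 (fun _ : ι => H)) :
    rowMulOp φ h = ∑ l, mulOp (φ l) (h l) := by
  simp [rowMulOp]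

theorem adjoint_rowMulOp_apply (φ : ι → Mult (X := X) H) (f : H) :
    (rowMulOp φ).adjoint f = WithLp.toLp 2 fun l => (mulOp (φ l)).adjoint f := by
  refine ext_inner_right ℂ fun h => ?_
  rw [ContinuousLinearMap.adjoint_inner_left, rowMulOp_apply, inner_sum, PiLp.inner_apply]
  exact Finset.sum_congr rfl fun l _ => (ContinuousLinearMap.adjoint_inner_left _ _ _).symm

theorem multNorm_le_norm_rowMulOp (φ : ι → Mult (X := X) H) (l : ι) :
    multNorm (φ l) ≤ ‖rowMulOp φ‖ := by
  rw [multNorm, ← LinearIsometryEquiv.norm_map ContinuousLinearMap.adjoint (mulOp (φ l)),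
    ← LinearIsometryEquiv.norm_map ContinuousLinearMap.adjoint (rowMulOp φ)]
  refine ContinuousLinearMap.opNorm_le_bound _ (norm_nonneg _) fun f => ?_
  refine le_trans ?_ ((rowMulOp φ).adjoint.le_opNorm f)
  rw [adjoint_rowMulOp_apply]
  exact PiLp.norm_apply_le (WithLp.toLp 2 fun l => (mulOp (φ l)).adjoint f) l

theorem norm_rowMulOp_le_norm_matMulOp {r : ℕ} (Φ : Matrix (Fin r) (Fin r) (Mult (X := X) H))
    (i : Fin r) : ‖rowMulOp (Φ i)‖ ≤ ‖matMulOp Φ‖ := by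
  refine ContinuousLinearMap.opNorm_le_bound _ (norm_nonneg _) fun h => ?_
  rw [rowMulOp_apply, ← matMulOp_apply]
  exact (PiLp.norm_apply_le _ i).trans (ContinuousLinearMap.le_opNorm _ h)

end RowMultiplier

section VanishingKernel

variable {X H : Type*} [NormedAddCommGroup H] [InnerProductSpace ℂ H] [CompleteSpace H]
  [RKHS ℂ H X ℂ]

variable (H) in
/-- The reproducing kernel of the subspace of the functions in `H` that vanish at `p`. If
`k(p, p) = 0`, this subspace is `H` and the quotient has the value `0`, as it should. -/
noncomputable def kVanish (p x y : X) : ℂ := k H x y - k H x p * k H p y / k H p p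

theorem starProjection_orthogonal_apply_starProjection {𝕜 E : Type*} [RCLike 𝕜]
    [NormedAddCommGroup E] [InnerProductSpace 𝕜 E] {K : Submodule 𝕜 E} [K.HasOrthogonalProjection]
    {T : E →L[𝕜] E} (hT : ∀ v ∈ K, T v ∈ K) (v : E) :
    Kᗮ.starProjection (T (Kᗮ.starProjection v)) = Kᗮ.starProjection (T v) := by
  have hv : Kᗮ.starProjection (T (K.starProjection v)) = 0 :=
    Submodule.starProjection_orthogonal_apply_eq_zero (hT _ (K.starProjection_apply_mem v))
  rw [K.starProjection_orthogonal_val v, map_sub, map_sub, hv, sub_zero]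

theorem gram_starProjection_kerVec (p : X) :
    gram ℂ (fun x => (ℂ ∙ kerVec H p)ᗮ.starProjection (kerVec H x)) = .of (kVanish H p) := by
  have hp : ((‖kerVec H p‖ ^ 2 : ℝ) : ℂ) = k H p p := by
    rw [← inner_kerVec_kerVec, inner_self_eq_norm_sq_to_K]
    simp
  ext x y
  rw [Matrix.gram_apply, Submodule.inner_starProjection_left_eq_right,
    Submodule.starProjection_eq_self_iff.2 (Submodule.starProjection_apply_mem _ _),
    Submodule.starProjection_orthogonal_val, Submodule.starProjection_singleton, inner_sub_right,
    inner_smul_right]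
  simp only [inner_kerVec_kerVec, Complex.coe_algebraMap, hp, Matrix.of_apply, kVanish]
  ring

theorem posSemidef_kVanish_mul_of_norm_rowMulOp_le_one {ι : Type*} [Fintype ι]
    {φ : ι → Mult (X := X) H} (hφ : ‖rowMulOp φ‖ ≤ 1) (p : X) :
    (Matrix.of fun x y => kVanish H p x y *
      (1 - ∑ l, (φ l : X → ℂ) x * conj ((φ l : X → ℂ) y))).PosSemidef := by
  let P : H →L[ℂ] H := (ℂ ∙ kerVec H p)ᗮ.starProjection
  let v (x : X) : H := P (kerVec H x)
  let u (x : X) : PiLp 2 (fun _ : ι => H) := (rowMulOp φ).adjoint (v x)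
  have hPu (l : ι) (x : X) : P (u x l) = conj ((φ l : X → ℂ) x) • v x := by
    have hspan : ∀ h ∈ ℂ ∙ kerVec H p, (mulOp (φ l)).adjoint h ∈ ℂ ∙ kerVec H p := by
      intro h hh
      obtain ⟨c, rfl⟩ := Submodule.mem_span_singleton.1 hh
      rw [map_smul, adjoint_mulOp_kerVec]
      exact Submodule.smul_mem _ _ (Submodule.smul_mem _ _ (Submodule.mem_span_singleton_self _))
    simp only [u, adjoint_rowMulOp_apply, v, P]
    rw [starProjection_orthogonal_apply_starProjection hspan, adjoint_mulOp_kerVec, map_smul]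
  have hrow : (gram ℂ v - gram ℂ u).PosSemidef :=
    posSemidef_gram_sub_gram_map ((LinearIsometryEquiv.norm_map _ _).trans_le hφ) v
  have hproj (l : ι) : (gram ℂ (fun x => u x l) - gram ℂ (fun x => P (u x l))).PosSemidef :=
    posSemidef_gram_sub_gram_map (Submodule.starProjection_norm_le _) _
  convert hrow.add (Matrix.posSemidef_sum Finset.univ fun l _ => hproj l) using 1
  have hv := gram_starProjection_kerVec (H := H) p
  ext x y
  have hvxy : ⟪v x, v y⟫_ℂ = kVanish H p x y := congrFun₂ hv x y
  simp only [Matrix.add_apply, Matrix.sub_apply, Matrix.sum_apply, Matrix.gram_apply, hPu,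
    PiLp.inner_apply, Finset.sum_sub_distrib, inner_smul_left, inner_smul_right, hvxy,
    RCLike.conj_conj, Matrix.of_apply, mul_sub, Finset.mul_sum, sub_add_sub_cancel, mul_one]
  congr 1
  exact Finset.sum_congr rfl fun l _ => by ring

end VanishingKernel

section CompletePick

variable {X H : Type*} [NormedAddCommGroup H] [InnerProductSpace ℂ H] [CompleteSpace H]
  [RKHS ℂ H X ℂ]

theorem IsCompletePick.exists_row (hH : IsCompletePick (X := X) H) {r n : ℕ} (z : Fin n → X)
    (w : Fin n → Fin (r + 1) → ℂ)
    (h : (Matrix.of fun i j => k H (z i) (z j) * (1 - ∑ l, w i l * conj (w j l))).PosSemidef) :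
    ∃ φ : Fin (r + 1) → Mult (X := X) H,
      ‖rowMulOp φ‖ ≤ 1 ∧ ∀ l i, (φ l : X → ℂ) (z i) = w i l := by
  let W (i : Fin n) : Matrix (Fin (r + 1)) (Fin (r + 1)) ℂ := Matrix.of (Pi.single 0 (w i))
  let d : Fin (r + 1) → ℂ := Pi.single 0 1
  have hd : 0 ≤ d ∧ 0 ≤ 1 - d :=
    ⟨Pi.single_nonneg.2 zero_le_one, fun a => by cases a using Fin.cases <;> simp [d]⟩
  have hk : (Matrix.of fun i j => k H (z i) (z j)).PosSemidef := by
    simpa [gram_kerVec] using! (posSemidef_gram (𝕜 := ℂ) (kerVec H)).submatrix z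
  -- `W i` has first row `w i` and vanishes elsewhere, so its Pick matrix is block diagonal with the
  -- Pick matrix of `w` as one block and `r` copies of the Gram matrix of the kernel.
  have hsum : (Matrix.of (fun i j => k H (z i) (z j) * (1 - ∑ l, w i l * conj (w j l))) ⊗ₖ
      Matrix.diagonal d +
        Matrix.of (fun i j => k H (z i) (z j)) ⊗ₖ Matrix.diagonal (1 - d)).PosSemidef :=
    (h.kronecker (.diagonal hd.1)).add (hk.kronecker (.diagonal hd.2))
  have hW : (pickMatrix H z W).PosSemidef := by
    convert hsum using 1
    ext ⟨i, a⟩ ⟨j, b⟩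
    cases a using Fin.cases <;> cases b using Fin.cases <;>
      simp [pickMatrix, W, d, Matrix.mul_apply, Matrix.one_apply, Matrix.diagonal_apply,
        (Fin.succ_ne_zero _).symm]
  obtain ⟨Φ, hΦ, hΦW⟩ := hH (r + 1) n z W hW
  exact ⟨Φ 0, (norm_rowMulOp_le_norm_matMulOp Φ 0).trans hΦ, fun l i => by simp [hΦW, W]⟩

theorem IsNormalizedAt.k_left {x₀ : X} (hk : IsNormalizedAt H x₀) (x : X) : k H x₀ x = 1 := by
  rw [← conj_k, hk x, map_one]

theorem IsCompletePick.k_ne_zero (hH : IsCompletePick (X := X) H) {x₀ : X}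
    (hk : IsNormalizedAt H x₀) (x y : X) : k H x y ≠ 0 := by
  intro hxy
  -- If `k(x, y) = 0`, the values `1` at `x` and `-1` at `y` are interpolated by a contractive
  -- multiplier, which must have both values at `x₀` by the maximum principle.
  have hyx : k H y x = 0 := by rw [← conj_k, hxy, map_zero]
  obtain ⟨φ, hφ, hφxy⟩ := hH.exists_row (r := 0) ![x, y] ![fun _ => 1, fun _ => -1] (by
    convert Matrix.PosSemidef.zero using 1
    ext i j
    fin_cases i <;> fin_cases j <;> simp [hxy, hyx])
  have hφx : (φ 0 : X → ℂ) x = 1 := hφxy 0 0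
  have hφy : (φ 0 : X → ℂ) y = -1 := hφxy 0 1
  have hφ₀ := (multNorm_le_norm_rowMulOp φ 0).trans hφ
  have hx := apply_eq_of_norm_apply_eq_one (y := x₀) hφ₀ (x := x) (by simp [hφx])
    (by simp [hk.k_left])
  have hy := apply_eq_of_norm_apply_eq_one (y := x₀) hφ₀ (x := y) (by simp [hφy])
    (by simp [hk.k_left])
  norm_num [hφx, hφy, hx] at hy

variable (H) in
/-- The kernel whose positivity characterizes complete Pick kernels in the theorem of McCullough
and Quiggin. It is meaningful for kernels without zeros. -/
noncomputable def pickDefect (p x y : X) : ℂ := 1 - k H x p * k H p y / (k H p p * k H x y)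

open scoped MatrixOrder in
theorem IsCompletePick.posSemidef_pickDefect_change_base (hH : IsCompletePick (X := X) H)
    (h₀ : ∀ x y : X, k H x y ≠ 0) {n : ℕ} {z : Fin (n + 1) → X} {q : X}
    (hq : (Matrix.of fun i j => pickDefect H q (z i) (z j)).PosSemidef) (p : X) :
    (Matrix.of fun i j => pickDefect H p (z i) (z j)).PosSemidef := by
  obtain ⟨C, hC⟩ := CStarAlgebra.nonneg_iff_eq_star_mul_self.1 hq.nonneg
  let w (i l : Fin (n + 1)) : ℂ := conj (C l i)
  have hw (i j : Fin (n + 1)) : 1 - ∑ l, w i l * conj (w j l) =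
      k H (z i) q * k H q (z j) / (k H q q * k H (z i) (z j)) := by
    have hCij := congrFun₂ hC i j
    simp only [pickDefect, Matrix.of_apply, Matrix.star_eq_conjTranspose, Matrix.mul_apply,
      Matrix.conjTranspose_apply, RCLike.star_def] at hCij
    simp only [w, Complex.conj_conj, ← hCij, sub_sub_cancel]
  have hrank : (gram ℂ fun i => (k H q (z i) / k H q q) • kerVec H q).PosSemidef :=
    posSemidef_gram _
  have hscale : (gram ℂ fun i => (k H q (z i))⁻¹ • kerVec H q).PosSemidef := posSemidef_gram _
  obtain ⟨φ, hφ, hφz⟩ := hH.exists_row z w (by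
    convert hrank using 1
    ext i j
    simp only [hw, Matrix.of_apply, Matrix.gram_apply, inner_smul_left, inner_smul_right,
      inner_kerVec_kerVec, map_div₀, conj_k]
    field_simp [h₀])
  have hvanish : (Matrix.of fun i j => kVanish H p (z i) (z j) *
      (1 - ∑ l, w i l * conj (w j l))).PosSemidef := by
    simp only [← hφz]
    exact (posSemidef_kVanish_mul_of_norm_rowMulOp_le_one hφ p).submatrix z
  have hprod : (Matrix.of (fun i j => kVanish H p (z i) (z j) *
      (1 - ∑ l, w i l * conj (w j l))) ⊙
        gram ℂ fun i => (k H q (z i))⁻¹ • kerVec H q).PosSemidef := hvanish.hadamard hscale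
  convert hprod using 1
  ext i j
  simp only [Matrix.hadamard_apply, Matrix.of_apply, hw, Matrix.gram_apply, inner_smul_left,
    inner_smul_right, inner_kerVec_kerVec, map_inv₀, conj_k, pickDefect, kVanish]
  field_simp [h₀]

theorem IsCompletePick.posSemidef_pickDefect (hH : IsCompletePick (X := X) H)
    (h₀ : ∀ x y : X, k H x y ≠ 0) (n : ℕ) (z : Fin n → X) (p : X) :
    (Matrix.of fun i j => pickDefect H p (z i) (z j)).PosSemidef := by
  induction n generalizing p with
  | zero =>
    convert Matrix.PosSemidef.zero using 1
    exact Subsingleton.elim _ _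
  | succ n ih =>
    refine hH.posSemidef_pickDefect_change_base h₀ (q := z 0)
      (posSemidef_of_submatrix_succ (fun j => ?_) (fun i => ?_) (ih (z ∘ Fin.succ) (z 0))) p
    · simp [pickDefect, h₀]
    · simp [pickDefect, h₀, mul_comm]

/-- `b` represents the kernel as `k(x, y) = 1 / (1 - ⟨b x, b y⟩)`. Such a map identifies `H` with
a space of functions on a subset of the unit ball of `G` whose kernel is that of the
Drury–Arveson space. -/
def IsPickEmbedding (H : Type*) [NormedAddCommGroup H] [InnerProductSpace ℂ H] [CompleteSpace H]
    [RKHS ℂ H X ℂ] {G : Type*} [NormedAddCommGroup G] [InnerProductSpace ℂ G] (b : X → G) : Prop :=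
  ∀ x y, k H x y * (1 - ⟪b x, b y⟫_ℂ) = 1

theorem IsCompletePick.exists_isPickEmbedding {X : Type u} [RKHS ℂ H X ℂ]
    (hH : IsCompletePick (X := X) H) {x₀ : X} (hk : IsNormalizedAt H x₀) :
    ∃ (G : Type u) (_ : NormedAddCommGroup G) (_ : InnerProductSpace ℂ G) (b : X → G),
      IsPickEmbedding H b := by
  have h₀ := hH.k_ne_zero hk
  obtain ⟨G, _, _, b, hb⟩ := exists_gram_eq_of_posSemidef
    (posSemidef_of_forall_submatrix_fin (A := .of (pickDefect H x₀)) fun n z =>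
      hH.posSemidef_pickDefect h₀ n z x₀)
  refine ⟨G, inferInstance, inferInstance, b, fun x y => ?_⟩
  have hbxy : ⟪b x, b y⟫_ℂ = 1 - (k H x y)⁻¹ := by
    simpa [pickDefect, hk _, hk.k_left] using congrFun₂ hb x y
  rw [hbxy, sub_sub_cancel, mul_inv_cancel₀ (h₀ x y)]

end CompletePick

section Factorization

section InnerProductSpace

variable {𝕜 E : Type*} [RCLike 𝕜] [NormedAddCommGroup E] [InnerProductSpace 𝕜 E]

theorem inner_add_sub_inner_smul (f y y' : E) (d d' : 𝕜) :
    ⟪y + (d - ⟪f, y⟫_𝕜) • f, y' + (d' - ⟪f, y'⟫_𝕜) • f⟫_𝕜 =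
      ⟪y, y'⟫_𝕜 + conj d * d' - ⟪y, f⟫_𝕜 * ⟪f, y'⟫_𝕜 -
        (1 - ⟪f, f⟫_𝕜) * (conj (d - ⟪f, y⟫_𝕜) * (d' - ⟪f, y'⟫_𝕜)) := by
  simp only [inner_add_left, inner_add_right, inner_smul_left, inner_smul_right, map_sub,
    inner_conj_symm]
  ring

theorem norm_sub_inner_smul_le {f : E} (hf : ‖f‖ ≤ 1) (y : E) : ‖y - ⟪f, y⟫_𝕜 • f‖ ≤ ‖y‖ := by
  have h : ‖y - ⟪f, y⟫_𝕜 • f‖ ^ 2 =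
      ‖y‖ ^ 2 - ‖⟪f, y⟫_𝕜‖ ^ 2 - (1 - ‖f‖ ^ 2) * ‖⟪f, y⟫_𝕜‖ ^ 2 := by
    rw [norm_sub_sq (𝕜 := 𝕜), inner_smul_right, inner_mul_symm_re_eq_norm, norm_mul, norm_smul,
      norm_inner_symm y f]
    ring
  rw [← sq_le_sq₀ (norm_nonneg _) (norm_nonneg _), h]
  nlinarith [sq_nonneg ‖⟪f, y⟫_𝕜‖, pow_le_one₀ (n := 2) (norm_nonneg f) hf]

end InnerProductSpace

variable {X H G : Type*} [NormedAddCommGroup H] [InnerProductSpace ℂ H] [CompleteSpace H]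
  [RKHS ℂ H X ℂ] [NormedAddCommGroup G] [InnerProductSpace ℂ G] {b : X → G} {x₀ : X}

namespace IsPickEmbedding

theorem k_eq_one_add (hb : IsPickEmbedding H b) (x y : X) :
    k H x y = 1 + ⟪b x, b y⟫_ℂ * k H x y := by
  linear_combination hb x y

theorem exists_contraction (hb : IsPickEmbedding H b) :
    ∃ T : WithLp 2 (ℂ × (G ⊗[ℂ] H)) →L[ℂ] H, ‖T‖ ≤ 1 ∧
      ∀ c v h x, T (WithLp.toLp 2 (c, v ⊗ₜ h)) x = c + ⟪b x, v⟫_ℂ * h x := by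
  let e (x : X) : WithLp 2 (ℂ × (G ⊗[ℂ] H)) := WithLp.toLp 2 (1, b x ⊗ₜ kerVec H x)
  have he : gram ℂ e = gram ℂ (kerVec H) := by
    ext x y
    simp [e, inner_kerVec_kerVec, ← hb.k_eq_one_add]
  obtain ⟨T, hT, hTe⟩ := exists_contraction_apply_eq_inner (H := H) (e := e) (by
    rw [he, sub_self]
    exact .zero)
  refine ⟨T, hT, fun c v h x => ?_⟩
  simp [hTe, e, inner_kerVec_left]

/-- The function `x ↦ ⟨b x, v⟩` as a multiplier; for `v` in an orthonormal basis of `G` these are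
the coordinates of the embedding `b`, up to conjugation. -/
noncomputable def mult (hb : IsPickEmbedding H b) (v : G) : Mult (X := X) H :=
  ⟨fun x => ⟪b x, v⟫_ℂ, fun f => by
    obtain ⟨T, -, hT⟩ := hb.exists_contraction
    exact ⟨T (WithLp.toLp 2 (0, v ⊗ₜ f)), funext fun x => by simp [hT]⟩⟩

theorem mulOp_mult_apply (hb : IsPickEmbedding H b) (v : G) (f : H) (x : X) :
    mulOp (hb.mult v) f x = ⟪b x, v⟫_ℂ * f x :=
  mulOp_apply _ f x

theorem multNorm_mult_le (hb : IsPickEmbedding H b) (v : G) : multNorm (hb.mult v) ≤ ‖v‖ := by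
  obtain ⟨T, hT, hTe⟩ := hb.exists_contraction
  refine ContinuousLinearMap.opNorm_le_bound _ (norm_nonneg _) fun f => ?_
  have hf : mulOp (hb.mult v) f = T (WithLp.toLp 2 (0, v ⊗ₜ f)) := by
    ext x
    simp [mulOp_mult_apply, hTe]
  rw [hf]
  refine (T.le_of_opNorm_le hT _).trans_eq ?_
  simp

theorem norm_lt_one (hb : IsPickEmbedding H b) (x : X) : ‖b x‖ < 1 := by
  have h : ‖kerVec H x‖ ^ 2 * (1 - ‖b x‖ ^ 2) = 1 := by
    have hx := hb x x
    rw [← inner_kerVec_kerVec, inner_self_eq_norm_sq_to_K, inner_self_eq_norm_sq_to_K] at hx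
    apply Complex.ofReal_injective
    push_cast
    exact hx
  have hpos : 0 < 1 - ‖b x‖ ^ 2 := pos_of_mul_pos_right (h.symm ▸ one_pos) (sq_nonneg _)
  nlinarith [norm_nonneg (b x)]

theorem apply_eq_zero (hb : IsPickEmbedding H b) (hk : IsNormalizedAt H x₀) : b x₀ = 0 := by
  have h := hb x₀ x₀
  rwa [hk, one_mul, sub_eq_self, inner_self_eq_zero] at h

theorem kerVec_eq_add (hb : IsPickEmbedding H b) (hk : IsNormalizedAt H x₀) (w : X) :
    kerVec H w = kerVec H x₀ + mulOp (hb.mult (b w)) (kerVec H w) := by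
  ext x
  simpa [mulOp_mult_apply, kerVec_apply, hk x] using hb.k_eq_one_add x w

theorem posSemidef_gram_sub_gram (hb : IsPickEmbedding H b) (hk : IsNormalizedAt H x₀) (c : ℂ)
    (g : X → H) :
    (gram ℂ (fun w => WithLp.toLp 2 (c, b w ⊗ₜ[ℂ] g w)) -
      gram ℂ fun w => c • kerVec H x₀ + mulOp (hb.mult (b w)) (g w)).PosSemidef := by
  obtain ⟨T, hT, hTe⟩ := hb.exists_contraction
  have hT_eq : (fun w => c • kerVec H x₀ + mulOp (hb.mult (b w)) (g w)) =
      fun w => T (WithLp.toLp 2 (c, b w ⊗ₜ[ℂ] g w)) := by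
    funext w
    ext x
    simp [hTe, mulOp_mult_apply, kerVec_apply, hk x]
  rw [hT_eq]
  exact posSemidef_gram_sub_gram_map hT _

/-- The state equation `y = stateMap y` of the system whose transfer function is `w ↦ ⟨y_w, f⟩`,
where `(c, d)` is the input and `y_w` the state at `w`. The constant function `c` is written
as a multiple of `k_{x₀}`, which is `1` for a kernel that is normalized at `x₀`. -/
noncomputable def stateMap (hb : IsPickEmbedding H b) (x₀ : X) (f : H) (c d : ℂ) (w : X) (y : H) :
    H :=
  c • kerVec H x₀ + mulOp (hb.mult (b w)) (y + (d - ⟪f, y⟫_ℂ) • f)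

theorem existsUnique_isFixedPt_stateMap (hb : IsPickEmbedding H b) (x₀ : X) {f : H}
    (hf : ‖f‖ ≤ 1) (c d : ℂ) (w : X) :
    ∃! y, Function.IsFixedPt (hb.stateMap x₀ f c d w) y := by
  have hcontr : ContractingWith ‖mulOp (hb.mult (b w))‖₊ (hb.stateMap x₀ f c d w) := by
    refine ⟨(hb.multNorm_mult_le (b w)).trans_lt (hb.norm_lt_one w),
      lipschitzWith_iff_norm_sub_le.2 fun y y' => ?_⟩
    have hdiff : hb.stateMap x₀ f c d w y - hb.stateMap x₀ f c d w y' =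
        mulOp (hb.mult (b w)) ((y - y') - ⟪f, y - y'⟫_ℂ • f) := by
      rw [stateMap, stateMap, add_sub_add_left_eq_sub, ← map_sub, inner_sub_right]
      congr 1
      module
    rw [hdiff]
    exact (ContinuousLinearMap.le_opNorm _ _).trans
      (mul_le_mul_of_nonneg_left (norm_sub_inner_smul_le hf _) (norm_nonneg _))
  exact ⟨_, hcontr.fixedPoint_isFixedPt, fun y hy => hcontr.fixedPoint_unique hy⟩

theorem isFixedPt_stateMap_add_smul (hb : IsPickEmbedding H b) {f : H} {c d c' d' : ℂ} {w : X}
    {y y' : H} (hy : Function.IsFixedPt (hb.stateMap x₀ f c d w) y)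
    (hy' : Function.IsFixedPt (hb.stateMap x₀ f c' d' w) y') (a : ℂ) :
    Function.IsFixedPt (hb.stateMap x₀ f (c + a * c') (d + a * d') w) (y + a • y') := by
  have harg : y + a • y' + (d + a * d' - ⟪f, y + a • y'⟫_ℂ) • f =
      (y + (d - ⟪f, y⟫_ℂ) • f) + a • (y' + (d' - ⟪f, y'⟫_ℂ) • f) := by
    rw [inner_add_right, inner_smul_right]
    module
  rw [Function.IsFixedPt, stateMap] at hy hy' ⊢
  rw [harg, map_add, map_smul]
  linear_combination (norm := module) hy + a • hy'

theorem isFixedPt_stateMap_kerVec (hb : IsPickEmbedding H b) (hk : IsNormalizedAt H x₀) (f : H)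
    (w : X) : Function.IsFixedPt (hb.stateMap x₀ f 1 (conj (f w)) w) (kerVec H w) := by
  rw [Function.IsFixedPt, stateMap, ← inner_kerVec_left, inner_conj_symm, sub_self, zero_smul,
    add_zero, one_smul, ← hb.kerVec_eq_add hk]

theorem exists_mult_of_isFixedPt_stateMap (hb : IsPickEmbedding H b) (hk : IsNormalizedAt H x₀)
    {f : H} (hf : ‖f‖ ≤ 1) {c d : ℂ} (hcd : ‖c‖ ^ 2 + ‖d‖ ^ 2 ≤ 1) {y : X → H}
    (hy : ∀ w, Function.IsFixedPt (hb.stateMap x₀ f c d w) (y w)) :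
    ∃ θ : Mult (X := X) H, (∀ w, (θ : X → ℂ) w = ⟪y w, f⟫_ℂ) ∧ multNorm θ ≤ 1 := by
  let g (w : X) : H := y w + (d - ⟪f, y w⟫_ℂ) • f
  have hstate : (gram ℂ (fun w => WithLp.toLp 2 (c, b w ⊗ₜ[ℂ] g w)) - gram ℂ y).PosSemidef := by
    have hyg : (fun w => c • kerVec H x₀ + mulOp (hb.mult (b w)) (g w)) = y := funext hy
    have h := hb.posSemidef_gram_sub_gram hk c g
    rwa [hyg] at h
  have hinput : ((1 - ‖c‖ ^ 2 - ‖d‖ ^ 2) • gram ℂ (fun _ : X => (1 : ℂ))).PosSemidef :=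
    (posSemidef_gram _).smul (by linarith)
  have hdefect : ((1 - ‖f‖ ^ 2) • gram ℂ (fun w => d - ⟪f, y w⟫_ℂ)).PosSemidef :=
    (posSemidef_gram _).smul (sub_nonneg.2 (pow_le_one₀ (norm_nonneg _) hf))
  have hg : (gram ℂ g).PosSemidef := posSemidef_gram g
  have hker : (gram ℂ (kerVec H : X → H)).PosSemidef := posSemidef_gram _
  have hpick : (Matrix.of fun z w => k H z w * (1 - ⟪y z, f⟫_ℂ * conj ⟪y w, f⟫_ℂ)).PosSemidef := by
    -- `1 - ⟨y_z, f⟩ ⟨f, y_w⟩` is the sum of the entries of the matrices in `hstate`, `hinput`,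
    -- `hdefect` and of `(1 - ⟨b z, b w⟩) ⟨g z, g w⟩`, which the factor `k(z, w)` turns into
    -- `⟨g z, g w⟩`.
    have hsum : (gram ℂ (kerVec H : X → H) ⊙ (gram ℂ (fun w => WithLp.toLp 2 (c, b w ⊗ₜ[ℂ] g w)) -
        gram ℂ y + (1 - ‖c‖ ^ 2 - ‖d‖ ^ 2) • gram ℂ (fun _ : X => (1 : ℂ)) +
          (1 - ‖f‖ ^ 2) • gram ℂ fun w => d - ⟪f, y w⟫_ℂ) + gram ℂ g).PosSemidef :=
      (hker.hadamard ((hstate.add hinput).add hdefect)).add hg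
    convert hsum using 1
    ext (z : X) (w : X)
    have hgg : ⟪g z, g w⟫_ℂ = ⟪y z, y w⟫_ℂ + ‖d‖ ^ 2 - ⟪y z, f⟫_ℂ * ⟪f, y w⟫_ℂ -
        (1 - ‖f‖ ^ 2) * (conj (d - ⟪f, y z⟫_ℂ) * (d - ⟪f, y w⟫_ℂ)) := by
      simpa [inner_self_eq_norm_sq_to_K, Complex.conj_mul'] using
        inner_add_sub_inner_smul f (y z) (y w) d d
    simp only [Matrix.of_apply, Matrix.add_apply, Matrix.hadamard_apply, Matrix.gram_apply,
      Matrix.sub_apply, Matrix.smul_apply, WithLp.prod_inner_apply, TensorProduct.inner_tmul,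
      inner_kerVec_kerVec, inner_self_eq_norm_sq_to_K, inner_conj_symm, RCLike.inner_apply,
      Complex.coe_algebraMap, Complex.real_smul, Complex.ofReal_sub, Complex.ofReal_pow,
      Complex.ofReal_one, norm_one, one_pow, mul_one, map_sub]
    simp only [map_sub, inner_conj_symm] at hgg
    linear_combination -k H z w * hgg + ⟪g z, g w⟫_ℂ * hb z w
  obtain ⟨θ, hθ, hnorm⟩ := exists_mult_of_posSemidef hpick
  exact ⟨θ, congrFun hθ, hnorm⟩

theorem exists_factorization (hb : IsPickEmbedding H b) (hk : IsNormalizedAt H x₀) {f : H}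
    (hf : ‖f‖ ≤ 1) :
    ∃ φ ψ : Mult (X := X) H, multNorm φ ≤ 1 ∧ multNorm ψ ≤ 1 ∧ (ψ : X → ℂ) x₀ = 0 ∧
      ∀ w, f w = (φ : X → ℂ) w + f w * (ψ : X → ℂ) w := by
  choose u hu _ using hb.existsUnique_isFixedPt_stateMap x₀ hf 1 0
  choose v hv _ using hb.existsUnique_isFixedPt_stateMap x₀ hf 0 1
  obtain ⟨φ, hφu, hφ⟩ := hb.exists_mult_of_isFixedPt_stateMap hk hf (by simp) hu
  obtain ⟨ψ, hψv, hψ⟩ := hb.exists_mult_of_isFixedPt_stateMap hk hf (by simp) hv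
  refine ⟨φ, ψ, hφ, hψ, ?_, fun w => ?_⟩
  · have hv₀ : v x₀ = 0 := by
      rw [← hv x₀]
      ext x
      simp [stateMap, mulOp_mult_apply, hb.apply_eq_zero hk]
    rw [hψv, hv₀, inner_zero_left]
  · have hsum : Function.IsFixedPt (hb.stateMap x₀ f 1 (conj (f w)) w)
        (u w + conj (f w) • v w) := by
      simpa using hb.isFixedPt_stateMap_add_smul (hu w) (hv w) (conj (f w))
    have hkuv : kerVec H w = u w + conj (f w) • v w :=
      (hb.existsUnique_isFixedPt_stateMap x₀ hf 1 (conj (f w)) w).unique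
        (hb.isFixedPt_stateMap_kerVec hk f w) hsum
    calc f w = ⟪u w + conj (f w) • v w, f⟫_ℂ := by rw [← hkuv, inner_kerVec_left]
      _ = (φ : X → ℂ) w + f w * (ψ : X → ℂ) w := by
        rw [inner_add_left, inner_smul_left, RCLike.conj_conj, hφu, hψv]

end IsPickEmbedding

theorem IsNormalizedAt.one_sub_apply_ne_zero (hk : IsNormalizedAt H x₀) {ψ : Mult (X := X) H}
    (hψ : multNorm ψ ≤ 1) (hψ₀ : (ψ : X → ℂ) x₀ = 0) (x : X) : 1 - (ψ : X → ℂ) x ≠ 0 := by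
  intro hx
  have hψx : (ψ : X → ℂ) x = 1 := (sub_eq_zero.1 hx).symm
  have h := apply_eq_of_norm_apply_eq_one (y := x₀) hψ (x := x) (by simp [hψx])
    (by simp [hk.k_left])
  simp [hψ₀, hψx] at h

theorem smul_mem_smirnov {g : X → ℂ} (hg : g ∈ smirnov (X := X) H) (c : ℂ) :
    c • g ∈ smirnov (X := X) H := by
  obtain ⟨φ, ψ, hψ, rfl⟩ := hg
  exact ⟨c • φ, ψ, hψ, funext fun x => (mul_div_assoc c _ _).symm⟩

theorem range_subset_smirnov (h : ∀ f : H, ‖f‖ ≤ 1 → (f : X → ℂ) ∈ smirnov (X := X) H) :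
    Set.range (fun (f : H) (x : X) => f x) ⊆ smirnov (X := X) H := by
  rintro _ ⟨f, rfl⟩
  obtain rfl | hf := eq_or_ne f 0
  · exact h 0 (by simp)
  · have hunit : (‖f‖ : ℂ) • (((‖f‖ : ℂ)⁻¹ • f : H) : X → ℂ) ∈ smirnov (X := X) H :=
      smul_mem_smirnov (h _ (norm_smul_inv_norm hf).le) _
    have hnorm : (‖f‖ : ℂ) ≠ 0 := by simpa using hf
    rwa [← RKHS.coe_smul, smul_inv_smul₀ hnorm] at hunit

end Factorization

end PickSpace

theorem theorem1p1 {X : Type*} {H : Type*} [NormedAddCommGroup H] [InnerProductSpace ℂ H]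
    [CompleteSpace H] [RKHS ℂ H X ℂ] (hP : PickSpace.IsCompletePick (X := X) H)
    (x₀ : X) (hk : PickSpace.IsNormalizedAt H x₀) :
    (∀ f : H, ‖f‖ ≤ 1 →
      ∃ φ ψ : PickSpace.Mult (X := X) H,
        PickSpace.multNorm φ ≤ 1 ∧ PickSpace.multNorm ψ ≤ 1 ∧ (ψ : X → ℂ) x₀ = 0 ∧
        PickSpace.IsCyclicMult (1 - ψ) ∧
        (∀ x : X, 1 - (ψ : X → ℂ) x ≠ 0) ∧
        ∀ x : X, f x = (φ : X → ℂ) x / (1 - (ψ : X → ℂ) x)) ∧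
    Set.range (fun (f : H) (x : X) => f x) ⊆ PickSpace.smirnov (X := X) H := by
  refine (and_iff_left_of_imp fun hfactor => PickSpace.range_subset_smirnov fun f hf => ?_).2
    fun f hf => ?_
  · obtain ⟨φ, ψ, -, -, -, hcyc, -, hfφψ⟩ := hfactor f hf
    exact ⟨φ, 1 - ψ, hcyc, funext hfφψ⟩
  · obtain ⟨G, _, _, b, hb⟩ := hP.exists_isPickEmbedding hk
    obtain ⟨φ, ψ, hφ, hψ, hψ₀, hfφψ⟩ := hb.exists_factorization hk hf
    have hψ₁ := hk.one_sub_apply_ne_zero hψ hψ₀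
    refine ⟨φ, ψ, hφ, hψ, hψ₀, PickSpace.isCyclicMult_one_sub hψ hψ₁, hψ₁, fun x => ?_⟩
    rw [eq_div_iff (hψ₁ x)]
    linear_combination hfφψ x
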